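/- For a (Hausdorff) topological group $G$, let $\mathbf{n}(G)$ denote its von Neumann radical, that is, the kernel of the canonical homomorphism from $G$ into its Bohr compactification; equivalently, the set of all elements of $G$ that are mapped to the identity by every continuous homomorphism from $G$ into a compact Hausdorff group. A Hausdorff topological group $G$ is called almost maximally almost-periodic if $\mathbf{n}(G)$ is non-trivial and finite. Theorem A. Let $A$ be an abelian group whose torsion subgroup is infinite. Then there is a Hausdorff group topology $\tau$ on $A$ such that $(A,\tau)$ is almost maximally almost-periodic, i.e., $\mathbf{n}(A,\tau)$ is non-trivial and finite. -/

import Mathlib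

universe u

/-- A continuous homomorphism `ρ : G → B` exhibits `B` as the Bohr compactification of the
topological group `G`: `B` is a compact Hausdorff group (the group operation is written additively,
but none of the target groups is assumed to be commutative), and every continuous homomorphism from
`G` into a compact Hausdorff group factors uniquely through `ρ`. -/
structure IsBohrCompactification {G B : Type u} [AddGroup G] [TopologicalSpace G]
    [AddGroup B] [TopologicalSpace B] (ρ : G →ₜ+ B) : Prop where
  isTopologicalAddGroup : IsTopologicalAddGroup B
  compactSpace : CompactSpace B
  t2Space : T2Space B
  existsUnique_factor : ∀ (K : Type u) [AddGroup K] [TopologicalSpace K] [IsTopologicalAddGroup K]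
    [CompactSpace K] [T2Space K] (φ : G →ₜ+ K), ∃! ψ : B →ₜ+ K, ∀ x : G, ψ (ρ x) = φ x

/-- The von Neumann radical of a topological group `G` (written additively, not assumed to be
commutative): the set of all elements that are killed by every continuous homomorphism from `G` into
a compact Hausdorff group, commutative or not. It is the kernel of the canonical map from `G` to its
Bohr compactification, see `vonNeumannRadical_eq_ker`.
Compact groups in the universe of `G` suffice: the closure of the image of `G` in a compact
Hausdorff group has at most as many elements as `Set (Set G)`. -/
def vonNeumannRadical (G : Type u) [AddGroup G] [TopologicalSpace G] : AddSubgroup G where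
  carrier := {x | ∀ (K : Type u) [AddGroup K] [TopologicalSpace K] [IsTopologicalAddGroup K]
    [CompactSpace K] [T2Space K] (φ : G →ₜ+ K), φ x = 0}
  zero_mem' := fun K _ _ _ _ _ φ => map_zero φ
  add_mem' := fun {x y} hx hy K _ _ _ _ _ φ => by rw [map_add, hx K φ, hy K φ, add_zero]
  neg_mem' := fun {x} hx K _ _ _ _ _ φ => by rw [map_neg, hx K φ, neg_zero]

/-- The von Neumann radical is the kernel of the canonical map to the Bohr compactification. -/
theorem vonNeumannRadical_eq_ker {G B : Type u} [AddGroup G] [TopologicalSpace G]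
    [AddGroup B] [TopologicalSpace B] (ρ : G →ₜ+ B) (hρ : IsBohrCompactification ρ) :
    vonNeumannRadical G = ρ.toAddMonoidHom.ker := by
  ext x
  constructor
  · intro hx
    have := hρ.isTopologicalAddGroup
    have := hρ.compactSpace
    have := hρ.t2Space
    exact hx B ρ
  · intro hx K _ _ _ _ _ φ
    obtain ⟨ψ, hψ, -⟩ := hρ.existsUnique_factor K φ
    have h0 : ρ x = 0 := hx
    rw [← hψ x, h0, map_zero]

/-- A topological group is almost maximally almost-periodic if it is Hausdorff and its von Neumann
radical is non-trivial, but finite. -/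
structure IsAlmostMaximallyAlmostPeriodic (G : Type u) [AddGroup G] [TopologicalSpace G] :
    Prop where
  isTopologicalAddGroup : IsTopologicalAddGroup G
  t2Space : T2Space G
  radical_ne_bot : vonNeumannRadical G ≠ ⊥
  radical_finite : (vonNeumannRadical G : Set G).Finite

open Topology Filter

/-! Fix `x₀ ≠ 0` of finite order and elements `g v` indexed by lists, the vertices of the shift
graph; a decreasing list `e` is an edge joining `e.tail` to `e.dropLast`. The topology forces `x₀ -
g e.tail + g e.dropLast` to tend to zero as `e.length` grows.

A homomorphism into a compact group induces finite colourings of the vertices. No finite colouring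
is proper on long edges, so some long edge has ends with nearly equal images, and `x₀` is killed
(`mem_vonNeumannRadical_shift`). Yet the graph is sparse: a cycle mod `m` with few edges has
coefficient sum zero (`shift_chain_sum_eq_zero`), which keeps the nonzero multiples of `x₀` away
from zero. Characters that kill `x₀` and decay along `g` are continuous and detect all other
elements. Hence the topology is Hausdorff and the radical lies in the finite group generated by
`x₀`.

What this needs from `g` is `IsThinFamily`. An infinite torsion subgroup supplies it
(`exists_isThinFamily`): there is an infinite `p`-socle, or torsion at infinitely many primes, or a
Prüfer subgroup. -/

/-! ### Combinatorics of the shift graph. -/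

/-- A colouring of longer lists induces one of shorter lists: colour `l` by the set of colours of
its decreasing extensions `y :: l`. A monochromatic edge for the induced colouring lifts to one for
`c`. -/
theorem exists_shift_edge_of_finite_coloring (k : ℕ) : ∀ {α : Type u} [Finite α] (c : List ℕ → α),
    ∃ e : List ℕ, e.length = k + 2 ∧ e.Pairwise (· > ·) ∧ c e.tail = c e.dropLast := by
  induction k with
  | zero =>
    intro α _ c
    obtain ⟨x, y, hne, h⟩ := Finite.exists_ne_map_eq_of_infinite (fun n : ℕ => c [n])
    rcases lt_or_gt_of_ne hne with h' | h'
    · exact ⟨[y, x], rfl, by simpa using h', h⟩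
    · exact ⟨[x, y], rfl, by simpa using h', h.symm⟩
  | succ k ih =>
    intro α _ c
    obtain ⟨e, hlen, hdec, hc⟩ :=
      ih (fun l => {a : α | ∃ y, (y :: l).Pairwise (· > ·) ∧ c (y :: l) = a})
    obtain ⟨a, l, rfl⟩ := List.exists_cons_of_length_eq_add_one hlen
    have hl : l ≠ [] := by rintro rfl; simp at hlen
    have hmem : c (a :: l) ∈
        {a' : α | ∃ y, (y :: (a :: l).tail).Pairwise (· > ·) ∧ c (y :: (a :: l).tail) = a'} :=
      ⟨a, hdec, rfl⟩
    rw [hc] at hmem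
    obtain ⟨y, hy, hyc⟩ := hmem
    rw [List.dropLast_cons_of_ne_nil hl] at hy hyc
    have hya : y > a := (List.pairwise_cons.1 hy).1 a (by simp)
    refine ⟨y :: a :: l, by simpa using hlen, List.pairwise_cons.2 ⟨?_, hdec⟩, ?_⟩
    · intro z hz
      rcases List.mem_cons.1 hz with rfl | hz
      · exact hya
      · exact ((List.pairwise_cons.1 hdec).1 z hz).trans hya
    · rw [List.dropLast_cons_of_ne_nil (by simp), List.dropLast_cons_of_ne_nil hl]
      exact hyc.symm

/-- Pushing `f` forward along `List.dropLast` keeps the coefficient sum, and keeps `f` a cycle since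
`tail` and `dropLast` commute. Lengths drop by one and so do the numbers of edges of each length, so
the count condition survives until nothing is left. -/
theorem shift_chain_sum_eq_zero {R : Type*} [AddCommMonoid R] (n : ℕ) :
    ∀ f : List ℕ →₀ R, (∀ e ∈ f.support, e.length ≤ n) →
      (∀ e ∈ f.support, e.Pairwise (· > ·)) →
      (∀ e ∈ f.support, (f.support.filter (fun e' => e'.length = e.length)).card < e.length) →
      f.mapDomain List.tail = f.mapDomain List.dropLast →
      f.sum (fun _ r => r) = 0 := by
  classical
  induction n with
  | zero =>
    intro f hn _ hcard _
    have : f = 0 := by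
      rw [← Finsupp.support_eq_empty, Finset.eq_empty_iff_forall_notMem]
      intro e he
      have h1 := hn e he
      have h2 := hcard e he
      omega
    simp [this]
  | succ n ih =>
    intro f hn hdec hcard hbd
    have hsub : (f.mapDomain List.dropLast).support ⊆ f.support.image List.dropLast :=
      Finsupp.mapDomain_support
    have hsum : f.sum (fun _ r => r) = (f.mapDomain List.dropLast).sum (fun _ r => r) := by
      rw [Finsupp.sum_mapDomain_index] <;> simp
    rw [hsum]
    apply ih
    · intro v hv
      obtain ⟨e, he, rfl⟩ := Finset.mem_image.1 (hsub hv)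
      have := hn e he
      simp only [List.length_dropLast]
      omega
    · intro v hv
      obtain ⟨e, he, rfl⟩ := Finset.mem_image.1 (hsub hv)
      exact (hdec e he).sublist (List.dropLast_sublist e)
    · intro v hv
      obtain ⟨e₀, he₀, rfl⟩ := Finset.mem_image.1 (hsub hv)
      have hc := hcard e₀ he₀
      set S := f.support.filter (fun e' => e'.length = e₀.length) with hS
      obtain ⟨e, heS, hmax⟩ := S.exists_max_image List.headI ⟨e₀, by simpa [hS] using he₀⟩
      have he := (Finset.mem_filter.1 heS)
      have hSpos : 0 < S.card := Finset.card_pos.2 ⟨e, heS⟩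
      -- Since `f` is a cycle, a surviving `e.dropLast` would be the tail of some edge `e'`, whose
      -- head exceeds that of `e`, against maximality. The count condition excludes edges of length
      -- at most one.
      have hw : e.dropLast ∉ (f.mapDomain List.dropLast).support := by
        intro hmem
        rw [← hbd] at hmem
        obtain ⟨e', he', heq⟩ := Finset.mem_image.1 (Finsupp.mapDomain_support hmem)
        have hlen := congrArg List.length heq
        have h' := hcard e' he'
        simp only [List.length_tail, List.length_dropLast] at hlen
        have hle : e'.headI ≤ e.headI := hmax e' (by
          rw [hS, Finset.mem_filter]; exact ⟨he', by omega⟩)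
        match e', e, he', heq, he, hle with
        | [], _, _, _, _, _ => simp at h'
        | _ :: _, [], _, _, he, _ => have := he.2; simp at this; omega
        | y :: l, [a], _, _, he, _ => have := he.2; simp at this; omega
        | y :: l, a :: b :: t, he', heq, _, hle =>
          have := (List.pairwise_cons.1 (hdec _ he')).1 a (by
            have heq' : l = a :: (b :: t).dropLast := by simpa using heq
            simp [heq'])
          simp at hle
          omega
      have hlt : ((f.mapDomain List.dropLast).support.filter
          (fun e' => e'.length = e₀.dropLast.length)).card < S.card := by
        calc _ ≤ ((S.image List.dropLast).erase e.dropLast).card := by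
              apply Finset.card_le_card
              intro v hv
              rw [Finset.mem_filter] at hv
              obtain ⟨e', he', rfl⟩ := Finset.mem_image.1 (hsub hv.1)
              have h' := hcard e' he'
              have hl := hv.2
              simp only [List.length_dropLast] at hl
              refine Finset.mem_erase.2 ⟨fun h => hw (h ▸ hv.1), Finset.mem_image_of_mem _ ?_⟩
              rw [hS, Finset.mem_filter]
              exact ⟨he', by omega⟩
          _ < (S.image List.dropLast).card :=
              Finset.card_erase_lt_of_mem (Finset.mem_image_of_mem _ heS)
          _ ≤ S.card := Finset.card_image_le
      simp only [List.length_dropLast] at hlt ⊢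
      omega
    · conv_rhs => rw [← hbd]
      rw [← Finsupp.mapDomain_comp, ← Finsupp.mapDomain_comp]
      congr 1
      funext l
      simp [Function.comp, List.tail_dropLast]

/-! ### Thin families and the group topology of the shift graph. -/

/-- A family `g` of elements of an abelian group, together with an element `x₀` of finite order,
such that integer combinations of `g` with coefficients bounded by `b` meet the cyclic group
generated by `x₀` trivially, while characters along which `g` decays like `1 / b` separate the
elements outside this cyclic group from zero. -/
structure IsThinFamily {A ι : Type*} [AddCommGroup A] (x₀ : A) (m : ℕ) (g : ι → A) (b : ι → ℕ) :
    Prop where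
  ne_zero : x₀ ≠ 0
  pos : 0 < m
  smul_eq_zero : m • x₀ = 0
  dvd_and_sum_eq_zero : ∀ c : ι →₀ ℤ, (∀ i, |c i| ≤ b i) →
    (c.sum fun i z => z • g i) ∈ AddSubgroup.zmultiples x₀ →
    (∀ i, (m : ℤ) ∣ c i) ∧ (c.sum fun i z => z • g i) = 0
  exists_character : ∀ y ∉ AddSubgroup.zmultiples x₀, ∃ χ : A →+ UnitAddCircle, ∃ C : ℝ,
    χ y ≠ 0 ∧ χ x₀ = 0 ∧ ∀ i, b i * ‖χ (g i)‖ ≤ C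

/-- The element attached to an edge `e` of the shift graph: the edge joins `e.tail` to
`e.dropLast`. -/
def shiftElement {A : Type*} [AddCommGroup A] (x₀ : A) (g : List ℕ → A) (e : List ℕ) : A :=
  x₀ - g e.tail + g e.dropLast

/-- The weight of an integer chain on the edges of the shift graph. -/
noncomputable def shiftWeight (f : List ℕ →₀ ℤ) : ℝ := f.sum fun e z => |(z : ℝ)| / e.length

/-- Chains on the edges of the shift graph, an edge being a non-empty decreasing list. -/
def IsShiftChain (f : List ℕ →₀ ℤ) : Prop := ∀ e ∈ f.support, e ≠ [] ∧ e.Pairwise (· > ·)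

/-- The value of a chain in the group. -/
def shiftValue {A : Type*} [AddCommGroup A] (x₀ : A) (g : List ℕ → A) (f : List ℕ →₀ ℤ) : A :=
  f.sum fun e z => z • shiftElement x₀ g e

/-- The basic neighbourhoods of zero. -/
def shiftNhd {A : Type*} [AddCommGroup A] (x₀ : A) (g : List ℕ → A) (ε : ℝ) : Set A :=
  {x | ∃ f, IsShiftChain f ∧ shiftWeight f < ε ∧ shiftValue x₀ g f = x}

theorem shiftWeight_add_le (f f' : List ℕ →₀ ℤ) :
    shiftWeight (f + f') ≤ shiftWeight f + shiftWeight f' := by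
  classical
  unfold shiftWeight
  rw [Finsupp.sum_of_support_subset (f + f') Finsupp.support_add _ (by simp),
    Finsupp.sum_of_support_subset f (Finset.subset_union_left (s₂ := f'.support)) _ (by simp),
    Finsupp.sum_of_support_subset f' (Finset.subset_union_right (s₁ := f.support)) _ (by simp),
    ← Finset.sum_add_distrib]
  refine Finset.sum_le_sum fun e _ => ?_
  rw [← add_div]
  gcongr
  simpa using abs_add_le (f e : ℝ) (f' e)

theorem shiftWeight_neg (f : List ℕ →₀ ℤ) : shiftWeight (-f) = shiftWeight f := by
  simp [shiftWeight, Finsupp.sum]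

theorem shiftValue_add {A : Type*} [AddCommGroup A] (x₀ : A) (g : List ℕ → A)
    (f f' : List ℕ →₀ ℤ) :
    shiftValue x₀ g (f + f') = shiftValue x₀ g f + shiftValue x₀ g f' :=
  Finsupp.sum_add_index' (by simp) (by intros; rw [add_smul])

theorem shiftValue_neg {A : Type*} [AddCommGroup A] (x₀ : A) (g : List ℕ → A)
    (f : List ℕ →₀ ℤ) : shiftValue x₀ g (-f) = -shiftValue x₀ g f := by
  simp [shiftValue, Finsupp.sum]

theorem IsShiftChain.add {f f' : List ℕ →₀ ℤ} (hf : IsShiftChain f) (hf' : IsShiftChain f') :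
    IsShiftChain (f + f') := by
  classical
  intro e he
  rcases Finset.mem_union.1 (Finsupp.support_add he) with h | h
  exacts [hf e h, hf' e h]

theorem IsShiftChain.neg {f : List ℕ →₀ ℤ} (hf : IsShiftChain f) : IsShiftChain (-f) := by
  intro e he
  exact hf e (by simpa using he)

/-- The neighbourhoods `shiftNhd x₀ g ε` are a basis of a group topology. -/
@[reducible]
noncomputable def shiftBasis {A : Type*} [AddCommGroup A] (x₀ : A) (g : List ℕ → A) :
    AddGroupFilterBasis A :=
  addGroupFilterBasisOfComm {U | ∃ ε > 0, U = shiftNhd x₀ g ε} ⟨_, 1, one_pos, rfl⟩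
    (by
      rintro _ _ ⟨ε, hε, rfl⟩ ⟨δ, hδ, rfl⟩
      refine ⟨_, ⟨min ε δ, lt_min hε hδ, rfl⟩, ?_⟩
      rintro x ⟨f, hf, hw, rfl⟩
      exact ⟨⟨f, hf, hw.trans_le (min_le_left _ _), rfl⟩,
        ⟨f, hf, hw.trans_le (min_le_right _ _), rfl⟩⟩)
    (by
      rintro _ ⟨ε, hε, rfl⟩
      exact ⟨0, by simp [IsShiftChain], by simpa [shiftWeight] using hε, by simp [shiftValue]⟩)
    (by
      rintro _ ⟨ε, hε, rfl⟩
      refine ⟨_, ⟨ε / 2, half_pos hε, rfl⟩, ?_⟩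
      rintro _ ⟨_, ⟨f, hf, hw, rfl⟩, _, ⟨f', hf', hw', rfl⟩, rfl⟩
      exact ⟨f + f', hf.add hf', by linarith [shiftWeight_add_le f f'], shiftValue_add _ _ _ _⟩)
    (by
      rintro _ ⟨ε, hε, rfl⟩
      refine ⟨_, ⟨ε, hε, rfl⟩, ?_⟩
      rintro _ ⟨f, hf, hw, rfl⟩
      exact ⟨-f, hf.neg, by rwa [shiftWeight_neg], shiftValue_neg _ _ _⟩)

theorem shiftBasis_hasBasis {A : Type*} [AddCommGroup A] (x₀ : A) (g : List ℕ → A) :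
    (@nhds A (shiftBasis x₀ g).topology 0).HasBasis (fun ε : ℝ => 0 < ε) (shiftNhd x₀ g) := by
  constructor
  intro t
  rw [((shiftBasis x₀ g).nhds_zero_hasBasis).mem_iff]
  constructor
  · rintro ⟨_, ⟨ε, hε, rfl⟩, h⟩
    exact ⟨ε, hε, h⟩
  · rintro ⟨ε, hε, h⟩
    exact ⟨_, ⟨ε, hε, rfl⟩, h⟩

theorem mem_vonNeumannRadical_shift {A : Type u} [AddCommGroup A] (x₀ : A) (g : List ℕ → A) :
    x₀ ∈ @vonNeumannRadical A _ (shiftBasis x₀ g).topology := by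
  let _ := (shiftBasis x₀ g).topology
  intro K _ _ _ _ _ φ
  by_contra hne
  obtain ⟨V, hV, hVx⟩ : ∃ V ∈ 𝓝 (0 : K), φ x₀ ∉ V :=
    ⟨{φ x₀}ᶜ, isOpen_compl_singleton.mem_nhds (by simpa using Ne.symm hne), by simp⟩
  have hcont : Tendsto (fun p : K × K × K => p.1 + (p.2.1 - p.2.2)) (𝓝 (0, 0, 0)) (𝓝 0) := by
    have : Continuous (fun p : K × K × K => p.1 + (p.2.1 - p.2.2)) := by fun_prop
    simpa using this.tendsto (0, 0, 0)
  have hVpre := hcont hV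
  rw [mem_map, nhds_prod_eq, nhds_prod_eq, mem_prod_iff] at hVpre
  obtain ⟨W₁, hW₁, W₂, hW₂, hW⟩ := hVpre
  obtain ⟨W, hWn, W', hWn', hWW⟩ := mem_prod_iff.1 hW₂
  -- The finitely many centres of the cover serve as colours. Subtracting the centre on the right
  -- lets it cancel in a difference even if `K` is not commutative.
  obtain ⟨t, ht⟩ := IsCompact.elim_nhds_subcover (isCompact_univ (X := K))
    (fun a => (fun y => y - a) ⁻¹' (W ∩ W')) (fun a _ => by
      have : Continuous (fun y : K => y - a) := by fun_prop
      exact this.continuousAt.preimage_mem_nhds (by simpa using inter_mem hWn hWn'))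
  have hcol : ∀ v : List ℕ, ∃ a : t, φ (g v) - (a : K) ∈ W ∩ W' := by
    intro v
    obtain ⟨a, ha, h⟩ := Set.mem_iUnion₂.1 (ht.2 (Set.mem_univ (φ (g v))))
    exact ⟨⟨a, ha⟩, h⟩
  choose c hc using hcol
  have hφ : Tendsto φ (𝓝 0) (𝓝 0) := by
    simpa using φ.continuous_toFun.tendsto 0
  obtain ⟨ε, hε, hU⟩ := (shiftBasis_hasBasis x₀ g).mem_iff.1 (hφ hW₁)
  obtain ⟨k, hk⟩ := exists_nat_one_div_lt hε
  obtain ⟨e, hlen, hdec, hce⟩ := exists_shift_edge_of_finite_coloring k c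
  have hmem : shiftElement x₀ g e ∈ shiftNhd x₀ g ε := by
    refine ⟨Finsupp.single e 1, ?_, ?_, by simp [shiftValue]⟩
    · intro e' he'
      have := Finsupp.support_single_subset he'
      rw [Finset.mem_singleton] at this
      subst this
      exact ⟨by rintro rfl; simp at hlen, hdec⟩
    · rw [shiftWeight, Finsupp.sum_single_index (by simp)]
      refine lt_of_le_of_lt ?_ hk
      rw [hlen]
      simp only [Int.cast_one, abs_one, Nat.cast_add, Nat.cast_ofNat]
      gcongr
      norm_num
  have key : φ x₀ = φ (shiftElement x₀ g e) +
      ((φ (g e.tail) - c e.tail) - (φ (g e.dropLast) - c e.dropLast)) := by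
    have hx : x₀ = shiftElement x₀ g e + (g e.tail - g e.dropLast) := by
      rw [shiftElement]; abel
    rw [hce, sub_sub_sub_cancel_right, ← map_sub, ← map_add]
    exact congrArg φ hx
  apply hVx
  rw [key]
  exact hW (Set.mk_mem_prod (hU hmem) (hWW (Set.mk_mem_prod (hc _).1 (hc _).2)))

/-! ### Separation from zero and the size of the radical. -/

section Thin

variable {A : Type*} [AddCommGroup A] {x₀ : A} {m : ℕ} {g : List ℕ → A}

theorem shiftValue_eq (f : List ℕ →₀ ℤ) : shiftValue x₀ g f = (f.sum fun _ z => z) • x₀ +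
    (f.mapDomain List.dropLast - f.mapDomain List.tail).sum (fun v z => z • g v) := by
  rw [Finsupp.sum_sub_index (by intros; rw [sub_smul]),
    Finsupp.sum_mapDomain_index (by simp) (by intros; rw [add_smul]),
    Finsupp.sum_mapDomain_index (by simp) (by intros; rw [add_smul])]
  simp only [shiftValue, Finsupp.sum, shiftElement, smul_add, smul_sub, Finset.sum_add_distrib,
    Finset.sum_sub_distrib, Finset.sum_smul]
  abel

theorem sum_abs_lt_of_shiftWeight_lt_one {f : List ℕ →₀ ℤ} (hw : shiftWeight f < 1) {n : ℕ} (hn : 0 < n) :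
    ∑ e ∈ f.support.filter (fun e => e.length = n), |f e| < n := by
  have h : ∑ e ∈ f.support.filter (fun e => e.length = n), |(f e : ℝ)| / e.length < 1 :=
    lt_of_le_of_lt (Finset.sum_le_sum_of_subset_of_nonneg (Finset.filter_subset _ _)
      (fun _ _ _ => by positivity)) hw
  rw [Finset.sum_congr rfl (g := fun e => |(f e : ℝ)| / n)
    (fun e he => by rw [(Finset.mem_filter.1 he).2]), ← Finset.sum_div, div_lt_one (by positivity)]
    at h
  exact_mod_cast h

/-- All edges over `v` have length `v.length + 1`, so weight below 1 bounds their coefficients. The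
boundary of a chain is a difference of two such pushforwards, whence the bound `2 * (v.length + 1)`
for thin families. -/
theorem IsShiftChain.abs_mapDomain_le {f : List ℕ →₀ ℤ} (hf : IsShiftChain f)
    (hw : shiftWeight f < 1) {p : List ℕ → List ℕ} (hp : ∀ l, (p l).length = l.length - 1)
    (v : List ℕ) : |f.mapDomain p v| ≤ v.length + 1 := by
  classical
  rw [Finsupp.mapDomain, Finsupp.sum_apply, Finsupp.sum]
  simp only [Finsupp.single_apply]
  rw [← Finset.sum_filter]
  refine (Finset.abs_sum_le_sum_abs _ _).trans ?_
  refine le_trans (Finset.sum_le_sum_of_subset_of_nonneg (fun e he => ?_)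
    (fun _ _ _ => abs_nonneg _)) (sum_abs_lt_of_shiftWeight_lt_one hw (Nat.succ_pos v.length)).le
  rw [Finset.mem_filter] at he ⊢
  have := List.length_pos_iff.2 (hf e he.1).1
  rw [← he.2, hp]
  exact ⟨he.1, by omega⟩

theorem IsThinFamily.eq_zero_of_mem_shiftNhd
    (h : IsThinFamily x₀ m g (fun v => 2 * (v.length + 1))) {y : A}
    (hy : y ∈ AddSubgroup.zmultiples x₀) (hyU : y ∈ shiftNhd x₀ g 1) : y = 0 := by
  obtain ⟨f, hf, hw, rfl⟩ := hyU
  have hval := shiftValue_eq (x₀ := x₀) (g := g) f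
  set c := f.mapDomain List.dropLast - f.mapDomain List.tail with hc
  have hcmem : c.sum (fun v z => z • g v) ∈ AddSubgroup.zmultiples x₀ := by
    have : c.sum (fun v z => z • g v) = shiftValue x₀ g f - (f.sum fun _ z => z) • x₀ := by
      rw [hval]; abel
    rw [this]
    exact sub_mem hy (AddSubgroup.zsmul_mem_zmultiples _ _)
  obtain ⟨hdvd, hsum⟩ := h.dvd_and_sum_eq_zero c (fun v => by
    have h1 := hf.abs_mapDomain_le hw (fun _ => List.length_dropLast) v
    have h2 := hf.abs_mapDomain_le hw (fun _ => List.length_tail) v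
    have h3 := abs_sub (f.mapDomain List.dropLast v) (f.mapDomain List.tail v)
    simp only [hc, Finsupp.sub_apply]
    push_cast
    linarith [h1, h2, h3]) hcmem
  rw [hval, hsum, add_zero]
  let q : ℤ →+ ZMod m := Int.castAddHom (ZMod m)
  -- Thinness makes the boundary of `f` divisible by `m`, so the reduction of `f` is a cycle with
  -- fewer than `n` edges of each length `n`.
  let f' : List ℕ →₀ ZMod m := f.mapRange q (map_zero q)
  have hsupp : f'.support ⊆ f.support := Finsupp.support_mapRange
  have hzero : f'.sum (fun _ r => r) = 0 := by
    apply shift_chain_sum_eq_zero (f.support.sup List.length) f'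
    · exact fun e he => Finset.le_sup (hsupp he)
    · exact fun e he => (hf e (hsupp he)).2
    · intro e he
      have h0 := List.length_pos_iff.2 (hf e (hsupp he)).1
      have h1 := sum_abs_lt_of_shiftWeight_lt_one hw h0
      have h2 : ((f.support.filter (fun e' => e'.length = e.length)).card : ℤ) ≤
          ∑ e' ∈ f.support.filter (fun e' => e'.length = e.length), |f e'| := by
        rw [Finset.cast_card]
        refine Finset.sum_le_sum fun e' he' => Int.one_le_abs ?_
        exact Finsupp.mem_support_iff.1 (Finset.mem_filter.1 he').1
      have h3 := Finset.card_le_card (Finset.filter_subset_filter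
        (fun e' : List ℕ => e'.length = e.length) hsupp)
      omega
    · ext v
      have := (ZMod.intCast_zmod_eq_zero_iff_dvd _ m).2 (hdvd v)
      rw [hc, Finsupp.sub_apply, Int.cast_sub, sub_eq_zero] at this
      rw [Finsupp.mapDomain_mapRange _ _ _ _ (map_add q),
        Finsupp.mapDomain_mapRange _ _ _ _ (map_add q)]
      exact this.symm
  have hq : ((f.sum fun _ z => z : ℤ) : ZMod m) = 0 := by
    rw [← hzero, Finsupp.sum_mapRange_index (by simp)]
    simp [Finsupp.sum, q]
  obtain ⟨j, hj⟩ := (ZMod.intCast_zmod_eq_zero_iff_dvd _ m).1 hq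
  rw [hj, mul_comm, mul_smul, natCast_zsmul, h.smul_eq_zero, smul_zero]

theorem norm_character_shiftValue_le (χ : A →+ UnitAddCircle) {C : ℝ} (hχ : χ x₀ = 0)
    (hC : ∀ v : List ℕ, ((2 * (v.length + 1) : ℕ) : ℝ) * ‖χ (g v)‖ ≤ C) {f : List ℕ →₀ ℤ}
    (hf : IsShiftChain f) : ‖χ (shiftValue x₀ g f)‖ ≤ C * shiftWeight f := by
  rw [shiftValue, shiftWeight, Finsupp.sum, Finsupp.sum, map_sum, Finset.mul_sum]
  refine (norm_sum_le _ _).trans (Finset.sum_le_sum fun e he => ?_)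
  have hpos : 0 < (e.length : ℝ) := by exact_mod_cast List.length_pos_iff.2 (hf e he).1
  have hlen : 1 ≤ e.length := List.length_pos_iff.2 (hf e he).1
  have h1 := hC e.tail
  have h2 := hC e.dropLast
  rw [List.length_tail, Nat.sub_add_cancel hlen] at h1
  rw [List.length_dropLast, Nat.sub_add_cancel hlen] at h2
  have h3 : ‖χ (shiftElement x₀ g e)‖ ≤ ‖χ (g e.tail)‖ + ‖χ (g e.dropLast)‖ := by
    rw [shiftElement, map_add, map_sub, hχ, zero_sub]
    exact (norm_add_le _ _).trans (by rw [norm_neg])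
  have h4 : ‖χ (shiftElement x₀ g e)‖ ≤ C / e.length := by
    rw [le_div_iff₀ hpos]
    push_cast at h1 h2
    nlinarith
  rw [map_zsmul]
  calc _ ≤ |(f e : ℝ)| * ‖χ (shiftElement x₀ g e)‖ := by
        simpa [Int.norm_eq_abs] using norm_zsmul_le (f e) (χ (shiftElement x₀ g e))
    _ ≤ |(f e : ℝ)| * (C / e.length) := by gcongr
    _ = _ := by ring

end Thin

theorem IsThinFamily.isAlmostMaximallyAlmostPeriodic {A : Type u} [AddCommGroup A] {x₀ : A}
    {m : ℕ} {g : List ℕ → A} (h : IsThinFamily x₀ m g (fun v => 2 * (v.length + 1))) :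
    @IsAlmostMaximallyAlmostPeriodic A _ (shiftBasis x₀ g).topology := by
  let _ := (shiftBasis x₀ g).topology
  have hgrp : IsTopologicalAddGroup A := (shiftBasis x₀ g).isTopologicalAddGroup
  have hbas := shiftBasis_hasBasis x₀ g
  refine ⟨hgrp, IsTopologicalAddGroup.t2Space_of_zero_sep fun y hy => ?_, fun hbot => ?_, ?_⟩
  · by_cases hmem : y ∈ AddSubgroup.zmultiples x₀
    · exact ⟨_, hbas.mem_of_mem one_pos, fun hU => hy (h.eq_zero_of_mem_shiftNhd hmem hU)⟩
    · obtain ⟨χ, C, hχy, hχ, hC⟩ := h.exists_character y hmem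
      have hC0 : 0 ≤ C := le_trans (by positivity) (hC [])
      have hpos : 0 < ‖χ y‖ / (C + 1) := by positivity
      refine ⟨_, hbas.mem_of_mem hpos, ?_⟩
      rintro ⟨f, hf, hw, rfl⟩
      have := norm_character_shiftValue_le χ hχ hC hf
      rw [lt_div_iff₀ (by positivity)] at hw
      have : 0 < ‖χ (shiftValue x₀ g f)‖ := norm_pos_iff.2 hχy
      have : 0 ≤ shiftWeight f := Finset.sum_nonneg fun _ _ => by positivity
      nlinarith
  · have := mem_vonNeumannRadical_shift x₀ g
    rw [hbot, AddSubgroup.mem_bot] at this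
    exact h.ne_zero this
  · have hfin : (AddSubgroup.zmultiples x₀ : Set A).Finite :=
      (isOfFinAddOrder_iff_nsmul_eq_zero.2 ⟨m, h.pos, h.smul_eq_zero⟩).finite_zmultiples
    refine hfin.subset fun y hy => ?_
    by_contra hmem
    obtain ⟨χ, C, hχy, hχ, hC⟩ := h.exists_character y hmem
    have hC0 : 0 ≤ C := le_trans (by positivity) (hC [])
    have hcont : Continuous χ := by
      refine continuous_of_continuousAt_zero χ ?_
      rw [ContinuousAt, map_zero, hbas.tendsto_iff Metric.nhds_basis_ball]
      intro δ hδ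
      refine ⟨δ / (C + 1), by positivity, ?_⟩
      rintro _ ⟨f, hf, hw, rfl⟩
      have := norm_character_shiftValue_le χ hχ hC hf
      have : 0 ≤ shiftWeight f := Finset.sum_nonneg fun _ _ => by positivity
      rw [lt_div_iff₀ (by positivity)] at hw
      rw [mem_ball_zero_iff]
      nlinarith
    -- The radical tests only compact groups in the universe of `A`.
    let φ : A →ₜ+ ULift.{u} UnitAddCircle :=
      { toFun := fun x => ULift.up (χ x)
        map_zero' := by rw [map_zero]; rfl
        map_add' := fun x y => by rw [map_add]; rfl
        continuous_toFun := continuous_uliftUp.comp hcont }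
    have h0 := hy (ULift.{u} UnitAddCircle) φ
    exact hχy (congrArg ULift.down h0)

theorem IsThinFamily.comp_equiv {A ι κ : Type*} [AddCommGroup A] {x₀ : A} {m : ℕ} {g : κ → A}
    {b : ι → ℕ} (e : ι ≃ κ) (h : IsThinFamily x₀ m g (b ∘ e.symm)) :
    IsThinFamily x₀ m (g ∘ e) b where
  ne_zero := h.ne_zero
  pos := h.pos
  smul_eq_zero := h.smul_eq_zero
  dvd_and_sum_eq_zero c hc hmem := by
    have hsum : (c.sum fun i z => z • (g ∘ e) i) =
        (c.equivMapDomain e).sum fun i z => z • g i := by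
      rw [Finsupp.sum_equivMapDomain]; rfl
    rw [hsum] at hmem ⊢
    obtain ⟨h1, h2⟩ := h.dvd_and_sum_eq_zero (c.equivMapDomain e)
      (fun i => by simpa using hc (e.symm i)) hmem
    exact ⟨fun i => by simpa using h1 (e i), h2⟩
  exists_character y hy := by
    obtain ⟨χ, C, h1, h2, h3⟩ := h.exists_character y hy
    exact ⟨χ, C, h1, h2, fun i => by simpa using h3 (e i)⟩

/-! ### Extension of characters. -/

section Characters

variable {A : Type*} [AddCommGroup A]

/-- `ψ` descends to the range of `F` and extends to `A` because divisible groups are injective. -/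
theorem exists_character_comp_eq {M T : Type*} [AddCommGroup M] [AddCommGroup T] [DivisibleBy T ℤ]
    (F : M →+ A) (ψ : M →+ T) (h : F.ker ≤ ψ.ker) : ∃ χ : A →+ T, ∀ x, χ (F x) = ψ x := by
  obtain ⟨χ, hχ⟩ := (Module.Baer.of_divisible T).extension_property_addMonoidHom
    (QuotientAddGroup.kerLift F) (QuotientAddGroup.kerLift_injective F)
    (QuotientAddGroup.lift F.ker ψ h)
  exact ⟨χ, fun x => DFunLike.congr_fun hχ (x : M ⧸ F.ker)⟩

theorem exists_character_ne_zero_of_notMem (L : AddSubgroup A) {y : A} (hy : y ∉ L) :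
    ∃ χ : A →+ UnitAddCircle, χ y ≠ 0 ∧ ∀ z ∈ L, χ z = 0 := by
  have hy' : (y : A ⧸ L) ≠ 0 := by rwa [Ne, QuotientAddGroup.eq_zero_iff]
  obtain ⟨c, hc⟩ := CharacterModule.exists_character_apply_ne_zero_of_ne_zero hy'
  let r : AddCircle (1 : ℚ) →+ UnitAddCircle :=
    QuotientAddGroup.map _ _ (Rat.castHom ℝ).toAddMonoidHom (by
      rw [AddSubgroup.zmultiples_le]
      exact ⟨1, by simp⟩)
  have hr : Function.Injective r := by
    rw [injective_iff_map_eq_zero]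
    intro x
    induction x using QuotientAddGroup.induction_on with
    | H x =>
      intro h
      obtain ⟨n, hn⟩ := (QuotientAddGroup.eq_zero_iff ((x : ℚ) : ℝ)).1 h
      refine (QuotientAddGroup.eq_zero_iff x).2 ⟨n, ?_⟩
      simp only [zsmul_eq_mul, mul_one] at hn ⊢
      exact_mod_cast hn
  let c' : A ⧸ L →+ AddCircle (1 : ℚ) := c
  refine ⟨(r.comp c').comp (QuotientAddGroup.mk' L), ?_, fun z hz => ?_⟩
  · exact (map_ne_zero_iff r hr).2 hc
  · have : (z : A ⧸ L) = 0 := (QuotientAddGroup.eq_zero_iff z).2 hz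
    simp [this]

end Characters

/-! ### Thin families in a Prüfer group. -/

section Prufer

variable {A : Type*} [AddCommGroup A] {p : ℕ}

theorem pow_nsmul_add_of_nsmul_succ {u : ℕ → A} (hu : ∀ n, p • u (n + 1) = u n) (n k : ℕ) :
    p ^ k • u (n + k) = u n := by
  induction k with
  | zero => simp
  | succ k ih => rw [pow_succ, mul_smul, ← add_assoc, hu, ih]

theorem exists_eq_zsmul_of_nsmul_succ {u : ℕ → A} (hu : ∀ n, p • u (n + 1) = u n)
    (c : ℕ →₀ ℤ) : ∃ (n : ℕ) (z : ℤ), Finsupp.linearCombination ℤ u c = z • u n := by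
  induction c using Finsupp.induction_linear with
  | zero => exact ⟨0, 0, by simp⟩
  | add f f' hf hf' =>
    obtain ⟨n, z, h⟩ := hf
    obtain ⟨n', z', h'⟩ := hf'
    refine ⟨n + n', z * (p ^ n' : ℕ) + z' * (p ^ n : ℕ), ?_⟩
    have h1 := pow_nsmul_add_of_nsmul_succ hu n n'
    have h2 := pow_nsmul_add_of_nsmul_succ hu n' n
    rw [add_comm n' n] at h2
    rw [map_add, h, h', add_smul, mul_smul, mul_smul, natCast_zsmul, natCast_zsmul, h1, h2]
  | single a b => exact ⟨a, b, by simp⟩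

theorem zsmul_eq_zero_iff_of_nsmul_succ [hp : Fact p.Prime] {u : ℕ → A}
    (hu : ∀ n, p • u (n + 1) = u n) (h0 : u 0 ≠ 0) (hp0 : p • u 0 = 0) (n : ℕ) (z : ℤ) :
    z • u n = 0 ↔ ((p ^ (n + 1) : ℕ) : ℤ) ∣ z := by
  have h := pow_nsmul_add_of_nsmul_succ hu 0 n
  rw [zero_add] at h
  rw [← addOrderOf_dvd_iff_zsmul_eq_zero, addOrderOf_eq_prime_pow (by rwa [h])
    (by rw [pow_succ', mul_smul, h, hp0])]

theorem exists_prufer_character [hp : Fact p.Prime] {u : ℕ → A}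
    (hu : ∀ n, p • u (n + 1) = u n) (h0 : u 0 ≠ 0) (hp0 : p • u 0 = 0) :
    ∃ χ : A →+ UnitAddCircle, ∀ n, χ (u n) = (((p : ℝ) ^ n)⁻¹ : ℝ) := by
  have hpne : (p : ℝ) ≠ 0 := by exact_mod_cast hp.out.ne_zero
  -- Pairing the two sequences makes one representation `z • v n` hold in both coordinates at once.
  let v : ℕ → A × UnitAddCircle := fun n => (u n, (((p : ℝ) ^ n)⁻¹ : ℝ))
  have hv : ∀ n, p • v (n + 1) = v n := by
    intro n
    refine Prod.ext (hu n) ?_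
    change p • ((((p : ℝ) ^ (n + 1))⁻¹ : ℝ) : UnitAddCircle) = _
    rw [← AddCircle.coe_nsmul, nsmul_eq_mul]
    congr 1
    field_simp
    ring
  have hfst : ∀ c, Finsupp.linearCombination ℤ u c = (Finsupp.linearCombination ℤ v c).1 :=
    fun c => by simp [Finsupp.linearCombination_apply, Finsupp.sum, Prod.fst_sum, v]
  have hsnd : ∀ c, Finsupp.linearCombination ℤ (fun n => (v n).2) c =
      (Finsupp.linearCombination ℤ v c).2 :=
    fun c => by simp [Finsupp.linearCombination_apply, Finsupp.sum, Prod.snd_sum]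
  obtain ⟨χ, hχ⟩ := exists_character_comp_eq (Finsupp.linearCombination ℤ u).toAddMonoidHom
    (Finsupp.linearCombination ℤ (fun n => (v n).2)).toAddMonoidHom (by
      intro c hc
      obtain ⟨n, z, h⟩ := exists_eq_zsmul_of_nsmul_succ hv c
      rw [AddMonoidHom.mem_ker] at hc ⊢
      simp only [LinearMap.toAddMonoidHom_coe] at hc ⊢
      rw [hfst, h] at hc
      rw [hsnd, h]
      obtain ⟨w, hw⟩ := (zsmul_eq_zero_iff_of_nsmul_succ hu h0 hp0 n z).1 hc
      change z • ((((p : ℝ) ^ n)⁻¹ : ℝ) : UnitAddCircle) = 0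
      rw [← AddCircle.coe_zsmul]
      refine (AddCircle.coe_eq_zero_iff _).2 ⟨p * w, ?_⟩
      rw [hw]
      push_cast
      simp only [zsmul_eq_mul]
      push_cast
      field_simp
      ring)
  refine ⟨χ, fun n => ?_⟩
  simpa [v] using hχ (Finsupp.single n 1)

theorem exists_isThinFamily_of_nsmul_succ [hp : Fact p.Prime] {u : ℕ → A}
    (hu : ∀ n, p • u (n + 1) = u n) (h0 : u 0 ≠ 0) (hp0 : p • u 0 = 0) (b : ℕ → ℕ) :
    ∃ g : ℕ → A, IsThinFamily (u 0) p g b := by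
  -- The gap `b i + 1` makes the order of `u (N (i + 1))` modulo the earlier terms exceed `b i`.
  set N : ℕ → ℕ := fun i => ∑ j ∈ Finset.range i, (b j + 1) with hN
  have hNsucc : ∀ i, N (i + 1) = N i + (b i + 1) := fun i => Finset.sum_range_succ _ _
  have hNmono : Monotone N := monotone_nat_of_le_succ fun i => by rw [hNsucc]; omega
  have hzero := zsmul_eq_zero_iff_of_nsmul_succ hu h0 hp0
  have hp1 : 1 < p := hp.out.one_lt
  refine ⟨fun i => u (N (i + 1)), h0, hp.out.pos, hp0, ?_, ?_⟩
  · intro c hc hmem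
    suffices c = 0 by subst this; simp
    by_contra hne
    obtain ⟨i, hi, hmax⟩ := c.support.exists_max_image id (Finsupp.support_nonempty_iff.2 hne)
    -- This multiplier kills `u 0` and all terms before the last index `i`, isolating `c i`.
    have hkill : ∀ k ≤ N i, ((p ^ (N i + 1) : ℕ) : ℤ) • u k = 0 := fun k hk =>
      (hzero k _).2 (by exact_mod_cast pow_dvd_pow p (by omega))
    have hsum : ((p ^ (N i + 1) : ℕ) : ℤ) • (c i • u (N (i + 1))) = 0 := by
      obtain ⟨a, ha⟩ := hmem
      have ha' := congrArg (fun x => ((p ^ (N i + 1) : ℕ) : ℤ) • x) ha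
      simp only [Finsupp.sum] at ha'
      rw [smul_comm, hkill 0 (Nat.zero_le _), smul_zero, Finset.smul_sum,
        Finset.sum_eq_single_of_mem i hi] at ha'
      · exact ha'.symm
      · intro j hj hji
        rw [smul_comm, hkill, smul_zero]
        exact hNmono (by have := hmax j hj; simp only [id] at this; omega)
    rw [← mul_smul, hzero, hNsucc] at hsum
    have hdvd : ((p ^ (b i + 1) : ℕ) : ℤ) ∣ c i := by
      have h1 : ((p ^ (N i + (b i + 1) + 1) : ℕ) : ℤ) =
          ((p ^ (N i + 1) : ℕ) : ℤ) * ((p ^ (b i + 1) : ℕ) : ℤ) := by push_cast; ring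
      rw [h1] at hsum
      exact (mul_dvd_mul_iff_left (by exact_mod_cast (pow_pos hp.out.pos _).ne')).1 hsum
    have hle := Int.le_of_dvd (abs_pos.2 (Finsupp.mem_support_iff.1 hi)) ((dvd_abs _ _).2 hdvd)
    have hlt : b i + 1 < p ^ (b i + 1) := Nat.lt_pow_self hp1
    have := hc i
    omega
  · intro y hy
    by_cases hyD : y ∈ (Submodule.span ℤ (Set.range u)).toAddSubgroup
    · obtain ⟨χ, hχ⟩ := exists_prufer_character hu h0 hp0
      refine ⟨χ, 1, fun hy0 => hy ?_, ?_, fun i => ?_⟩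
      · obtain ⟨c, rfl⟩ := (Finsupp.mem_span_range_iff_exists_finsupp).1 hyD
        obtain ⟨n, z, h⟩ := exists_eq_zsmul_of_nsmul_succ hu c
        rw [Finsupp.linearCombination_apply] at h
        rw [h] at hy0 ⊢
        rw [map_zsmul, hχ, ← AddCircle.coe_zsmul, AddCircle.coe_eq_zero_iff] at hy0
        obtain ⟨w, hw⟩ := hy0
        have hpn : (p : ℝ) ^ n ≠ 0 := pow_ne_zero _ (by exact_mod_cast hp.out.ne_zero)
        have hz : z = w * (p ^ n : ℕ) := by
          simp only [zsmul_eq_mul, mul_one] at hw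
          rw [eq_mul_inv_iff_mul_eq₀ hpn] at hw
          exact_mod_cast hw.symm
        have := pow_nsmul_add_of_nsmul_succ hu 0 n
        rw [zero_add] at this
        rw [hz, mul_smul, natCast_zsmul, this]
        exact AddSubgroup.zsmul_mem_zmultiples _ _
      · rw [hχ, pow_zero, inv_one]
        exact AddCircle.coe_period 1
      · rw [hχ]
        have hpos : (0 : ℝ) < (p : ℝ) ^ N (i + 1) := pow_pos (by exact_mod_cast hp.out.pos) _
        have h1 : ‖((((p : ℝ) ^ N (i + 1))⁻¹ : ℝ) : UnitAddCircle)‖ ≤ ((p : ℝ) ^ N (i + 1))⁻¹ := by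
          refine QuotientAddGroup.norm_mk_le_norm.trans ?_
          rw [Real.norm_of_nonneg (by positivity)]
        have h2 : (b i : ℝ) ≤ (p : ℝ) ^ N (i + 1) := by
          have h3 : N (i + 1) < p ^ N (i + 1) := Nat.lt_pow_self hp1
          have h4 := hNsucc i
          exact_mod_cast (by omega : b i ≤ p ^ N (i + 1))
        calc _ ≤ (p : ℝ) ^ N (i + 1) * ((p : ℝ) ^ N (i + 1))⁻¹ := by gcongr
          _ = 1 := mul_inv_cancel₀ hpos.ne'
    · obtain ⟨χ, hχy, hχ⟩ := exists_character_ne_zero_of_notMem _ hyD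
      have hmem : ∀ n, χ (u n) = 0 := fun n => hχ _ (Submodule.subset_span ⟨n, rfl⟩)
      exact ⟨χ, 0, hχy, hmem 0, fun i => by simp [hmem]⟩

end Prufer

/-! ### Thin families from independent elements of prime order. -/

/-- An element of prime order outside a subgroup generates a group meeting it trivially, so choosing
each term outside the span of `x₀` and its predecessors gives independence. A coefficient divisible
by `q` is then divisible by `m` if `q = m`, and zero if `q` exceeds the bound. -/
theorem exists_isThinFamily_of_forall_finite {A : Type*} [AddCommGroup A] {x₀ : A} {m : ℕ}
    (hx₀ : x₀ ≠ 0) (hm : 0 < m) (hmx : m • x₀ = 0)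
    (H : ∀ F : AddSubgroup A, Finite F → ∀ B : ℕ, ∃ h ∉ F, ∃ q : ℕ, q.Prime ∧ q • h = 0 ∧
      (q = m ∨ B < q)) (b : ℕ → ℕ) : ∃ g : ℕ → A, IsThinFamily x₀ m g b := by
  classical
  -- The sequence will be injective, so at stage `n` the set `t` of earlier terms has `n` elements
  -- and the supremum dominates `b n`.
  obtain ⟨v, hv⟩ := Set.seq_of_forall_finite_exists
    (P := fun (c : AddCommGroup.torsion A) (t : Set (AddCommGroup.torsion A)) =>
      (c : A) ∉ Submodule.span ℤ {x₀} ⊔ Submodule.span ℤ ((fun a : AddCommGroup.torsion A => (a : A)) '' t) ∧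
      ∃ q : ℕ, q.Prime ∧ q • (c : A) = 0 ∧
        (q = m ∨ (Finset.range (t.ncard + 1)).sup b < q)) (by
    intro t ht
    set F := Submodule.span ℤ {x₀} ⊔ Submodule.span ℤ ((fun a : AddCommGroup.torsion A => (a : A)) '' t) with hF
    have hfg : F.FG := (Submodule.fg_span (Set.finite_singleton x₀)).sup
      (Submodule.fg_span (ht.image _))
    have htor : F.toAddSubgroup ≤ AddCommGroup.torsion A := by
      have : F ≤ AddSubgroup.toIntSubmodule (AddCommGroup.torsion A) := by
        rw [hF, sup_le_iff, Submodule.span_le, Submodule.span_le]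
        refine ⟨?_, ?_⟩
        · rintro _ rfl
          exact isOfFinAddOrder_iff_nsmul_eq_zero.2 ⟨m, hm, hmx⟩
        · rintro _ ⟨a, -, rfl⟩
          exact a.2
      exact this
    have hfin : Finite F := by
      have : Module.Finite ℤ F := Module.Finite.iff_fg.2 hfg
      have : AddGroup.FG F := Module.Finite.iff_addGroup_fg.1 this
      refine AddCommGroup.finite_of_fg_isAddTorsion F fun x => ?_
      obtain ⟨n, hn, hx⟩ := isOfFinAddOrder_iff_nsmul_eq_zero.1 (htor x.2)
      exact isOfFinAddOrder_iff_nsmul_eq_zero.2 ⟨n, hn, Subtype.ext hx⟩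
    obtain ⟨h, hh, q, hq, hqh, hqm⟩ :=
      H F.toAddSubgroup hfin ((Finset.range (t.ncard + 1)).sup b)
    exact ⟨⟨h, isOfFinAddOrder_iff_nsmul_eq_zero.2 ⟨q, hq.pos, hqh⟩⟩, hh, q, hq, hqh, hqm⟩)
  choose hnot q hq hqv hqm using hv
  set g : ℕ → A := fun n => (v n : A) with hg
  have himage : ∀ n, (fun a : AddCommGroup.torsion A => (a : A)) '' (v '' Set.Iio n) =
      g '' Set.Iio n := fun n => by rw [Set.image_image]
  simp only [himage] at hnot
  have hinj : Function.Injective v := by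
    refine Function.injective_iff_pairwise_ne.2 ?_
    have : ∀ i j, i < j → v i ≠ v j := fun i j hij heq => hnot j (Submodule.mem_sup_right
      (Submodule.subset_span ⟨i, hij, congrArg Subtype.val heq⟩))
    intro i j hij
    rcases lt_or_gt_of_ne hij with h | h
    exacts [this i j h, (this j i h).symm]
  have hcard : ∀ n, (v '' Set.Iio n).ncard = n := fun n => by
    rw [Set.ncard_image_of_injective _ hinj, ← Finset.coe_Iio, Set.ncard_coe_finset, Nat.card_Iio]
  have hqb : ∀ n, q n = m ∨ b n < q n := fun n => (hqm n).imp_right fun h => by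
    rw [hcard] at h
    exact lt_of_le_of_lt (Finset.le_sup (Finset.self_mem_range_succ n)) h
  have hdvd : ∀ c : ℕ →₀ ℤ, Finsupp.linearCombination ℤ g c ∈ Submodule.span ℤ {x₀} →
      ∀ i, (q i : ℤ) ∣ c i := by
    intro c hc
    by_contra! hcon
    obtain ⟨i₀, hi₀⟩ := hcon
    obtain ⟨i, hi, hmax⟩ := (c.support.filter (fun i => ¬ (q i : ℤ) ∣ c i)).exists_max_image id
      ⟨i₀, Finset.mem_filter.2 ⟨Finsupp.mem_support_iff.2 fun h => hi₀ (by simp [h]), hi₀⟩⟩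
    rw [Finset.mem_filter] at hi
    refine hnot i ?_
    set F := Submodule.span ℤ {x₀} ⊔ Submodule.span ℤ (g '' Set.Iio i)
    have hci : c i • g i ∈ F := by
      rw [Finsupp.linearCombination_apply, Finsupp.sum, ← Finset.add_sum_erase _ _ hi.1] at hc
      have hrest : ∑ j ∈ c.support.erase i, c j • g j ∈ F := by
        refine Submodule.sum_mem _ fun j hj => ?_
        rw [Finset.mem_erase] at hj
        rcases lt_or_gt_of_ne hj.1 with hlt | hgt
        · exact F.smul_mem _ (Submodule.mem_sup_right (Submodule.subset_span ⟨j, hlt, rfl⟩))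
        · have : (q j : ℤ) ∣ c j := by
            by_contra hj'
            have := hmax j (Finset.mem_filter.2 ⟨hj.2, hj'⟩)
            simp only [id] at this
            omega
          obtain ⟨w, hw⟩ := this
          rw [hw, mul_comm, mul_smul, natCast_zsmul, hqv, smul_zero]
          exact F.zero_mem
      have := F.sub_mem (Submodule.mem_sup_left hc) hrest
      rwa [add_sub_cancel_right] at this
    have hcop : IsCoprime (q i : ℤ) (c i) :=
      (Nat.prime_iff_prime_int.1 (hq i)).irreducible.coprime_iff_not_dvd.2 hi.2
    obtain ⟨s, t, hst⟩ := hcop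
    have : g i = t • (c i • g i) := by
      conv_lhs => rw [← one_smul ℤ (g i), ← hst, add_smul, mul_smul, mul_smul, natCast_zsmul, hqv,
        smul_zero, zero_add]
    change g i ∈ F
    rw [this]
    exact F.smul_mem _ hci
  have hterm : ∀ c : ℕ →₀ ℤ, Finsupp.linearCombination ℤ g c ∈ Submodule.span ℤ {x₀} →
      ∀ i, c i • g i = 0 := fun c hc i => by
    obtain ⟨w, hw⟩ := hdvd c hc i
    rw [hw, mul_comm, mul_smul, natCast_zsmul, hqv, smul_zero]
  have hspan : ∀ y, y ∈ AddSubgroup.zmultiples x₀ ↔ y ∈ Submodule.span ℤ {x₀} := fun y => by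
    rw [AddSubgroup.mem_zmultiples_iff, Submodule.mem_span_singleton]
  refine ⟨g, hx₀, hm, hmx, fun c hc hmem => ?_, fun y hy => ?_⟩
  · have hmem' : Finsupp.linearCombination ℤ g c ∈ Submodule.span ℤ {x₀} := (hspan _).1 hmem
    refine ⟨fun i => ?_, Finset.sum_eq_zero fun i _ => hterm c hmem' i⟩
    have hd := hdvd c hmem' i
    rcases hqb i with h | h
    · rwa [← h]
    · have hlt : |c i| < q i := (hc i).trans_lt (by exact_mod_cast h)
      rw [Int.eq_zero_of_abs_lt_dvd hd hlt]
      exact dvd_zero _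
  -- By independence `y` avoids the span of `x₀` and some tail of `g`. A character killing that span
  -- has only finitely many nonzero values on `g`.
  · obtain ⟨n, hn⟩ : ∃ n, y ∉ Submodule.span ℤ {x₀} ⊔ Submodule.span ℤ (g '' Set.Ici n) := by
      by_contra! hall
      apply hy
      rw [hspan]
      obtain ⟨a, ha, w, hw, rfl⟩ := Submodule.mem_sup.1 (hall 0)
      obtain ⟨c, -, rfl⟩ := (Finsupp.mem_span_image_iff_linearCombination ℤ).1 hw
      obtain ⟨n, hn⟩ := c.support.bddAbove
      obtain ⟨a', ha', w', hw', heq⟩ := Submodule.mem_sup.1 (hall (n + 1))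
      obtain ⟨c', hc', rfl⟩ := (Finsupp.mem_span_image_iff_linearCombination ℤ).1 hw'
      have hdiff : Finsupp.linearCombination ℤ g (c - c') ∈ Submodule.span ℤ {x₀} := by
        have : Finsupp.linearCombination ℤ g (c - c') = a' - a := by
          rw [map_sub, sub_eq_sub_iff_add_eq_add, add_comm _ a, heq]
        rw [this]
        exact Submodule.sub_mem _ ha' ha
      have hzero : Finsupp.linearCombination ℤ g c = 0 := by
        refine Finset.sum_eq_zero fun i hi => ?_
        have hc'i : c' i = 0 := by
          by_contra h
          have h1 : n + 1 ≤ i := (Finsupp.mem_supported ℤ c').1 hc' (Finsupp.mem_support_iff.2 h)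
          have h2 : i ≤ n := hn hi
          omega
        simpa [hc'i] using hterm _ hdiff i
      rw [hzero, add_zero]
      exact ha
    obtain ⟨χ, hχy, hχ⟩ := exists_character_ne_zero_of_notMem
      (Submodule.span ℤ {x₀} ⊔ Submodule.span ℤ (g '' Set.Ici n)).toAddSubgroup hn
    have hnonneg : ∀ i ∈ Finset.range n, 0 ≤ (b i : ℝ) * ‖χ (g i)‖ := fun _ _ => by positivity
    refine ⟨χ, ∑ i ∈ Finset.range n, b i * ‖χ (g i)‖, hχy,
      hχ _ (Submodule.mem_sup_left (Submodule.mem_span_singleton_self x₀)), fun i => ?_⟩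
    by_cases hi : i < n
    · exact Finset.single_le_sum hnonneg (Finset.mem_range.2 hi)
    · rw [hχ (g i) (Submodule.mem_sup_right (Submodule.subset_span ⟨i, not_lt.1 hi, rfl⟩)),
        norm_zero, mul_zero]
      exact Finset.sum_nonneg hnonneg

/-! ### The trichotomy for infinite torsion. -/

section Torsion

variable {A : Type*} [AddCommGroup A]

theorem finite_setOf_nsmul_eq_zero (h : ∀ p : ℕ, p.Prime → {x : A | p • x = 0}.Finite) (n : ℕ) :
    n ≠ 0 → {x : A | n • x = 0}.Finite := by
  induction n using induction_on_primes with
  | zero => exact fun h => absurd rfl h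
  | one => intro _; simp
  | prime_mul p n hp ih =>
    intro hne
    have hn : {x : A | n • x = 0}.Finite := ih (right_ne_zero_of_mul hne)
    have : {x : A | (p * n) • x = 0} = (fun x => p • x) ⁻¹' {x | n • x = 0} := by
      ext x
      simp [mul_smul, smul_comm p n]
    rw [this]
    refine hn.preimage' fun z _ => ?_
    rcases ((fun x : A => p • x) ⁻¹' {z}).eq_empty_or_nonempty with he | ⟨y, hy⟩
    · rw [he]; exact Set.finite_empty
    · refine ((h p hp).image (fun x => y + x)).subset fun x hx => ⟨x - y, ?_, add_sub_cancel y x⟩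
      simp only [Set.mem_preimage, Set.mem_singleton_iff, Set.mem_ofPred_eq] at hx hy ⊢
      rw [smul_sub, hx, hy, sub_self]

/-- Otherwise each primary component has bounded exponent, so one `M ≠ 0` kills all torsion, and the
`M`-torsion is finite. -/
theorem exists_infinite_primary (hA : Infinite (AddCommGroup.torsion A))
    (h : ∀ p : ℕ, p.Prime → {x : A | p • x = 0}.Finite)
    (hP : {p : ℕ | p.Prime ∧ ∃ x : A, x ≠ 0 ∧ p • x = 0}.Finite) :
    ∃ p : ℕ, p.Prime ∧ {x : A | ∃ n : ℕ, p ^ n • x = 0}.Infinite := by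
  by_contra! hcon
  have hexp : ∀ p : ℕ, p.Prime → ∃ k : ℕ, ∀ x : A, (∃ n : ℕ, p ^ n • x = 0) → p ^ k • x = 0 := by
    intro p hp
    have hfin := hcon p hp
    choose! n hn using fun (x : A) (hx : ∃ n : ℕ, p ^ n • x = 0) => hx
    refine ⟨hfin.toFinset.sup n, fun x hx => ?_⟩
    have hle : n x ≤ hfin.toFinset.sup n := Finset.le_sup (hfin.mem_toFinset.2 hx)
    rw [← Nat.sub_add_cancel hle, pow_add, mul_smul, hn x hx, smul_zero]
  choose! k hk using hexp
  set M := ∏ p ∈ hP.toFinset, p ^ k p with hM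
  have hM0 : M ≠ 0 := Finset.prod_ne_zero_iff.2 fun p hp =>
    pow_ne_zero _ (hP.mem_toFinset.1 hp).1.ne_zero
  refine Set.infinite_coe_iff.1 hA ((finite_setOf_nsmul_eq_zero h M hM0).subset fun y hy => ?_)
  have hpos : 0 < addOrderOf y := IsOfFinAddOrder.addOrderOf_pos hy
  refine addOrderOf_dvd_iff_nsmul_eq_zero.1 ?_
  rw [Nat.dvd_iff_prime_pow_dvd_dvd]
  rintro p (_ | j) hp ⟨w, hw⟩
  · simp
  have hz : addOrderOf (w • y) = p ^ (j + 1) := by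
    rw [addOrderOf_nsmul_of_dvd (by rintro rfl; simp [hpos.ne'] at hw) ⟨_, by rw [hw, mul_comm]⟩,
      hw, Nat.mul_div_cancel _ (Nat.pos_of_ne_zero (by rintro rfl; simp [hpos.ne'] at hw))]
  have hz0 : p ^ (j + 1) • (w • y) = 0 := by rw [← hz, addOrderOf_nsmul_eq_zero]
  have hmem : p ∈ hP.toFinset := by
    refine hP.mem_toFinset.2 ⟨hp, p ^ j • (w • y), fun h0 => ?_, by rwa [← mul_smul, ← pow_succ']⟩
    have := Nat.le_of_dvd (pow_pos hp.pos _) (addOrderOf_dvd_iff_nsmul_eq_zero.2 h0)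
    rw [hz] at this
    exact absurd this (not_le.2 (Nat.pow_lt_pow_right hp.one_lt (Nat.lt_succ_self j)))
  have hdvd := addOrderOf_dvd_iff_nsmul_eq_zero.2 (hk p hp (w • y) ⟨_, hz0⟩)
  rw [hz] at hdvd
  exact hdvd.trans (Finset.dvd_prod_of_mem _ hmem)

/-- König's lemma for the tree of `p`-power roots: division by `p` branches finitely, so an element
with infinitely many such roots has a `p`-th root with the same property. -/
theorem exists_prufer_sequence {p : ℕ} (hfin : {x : A | p • x = 0}.Finite)
    (hinf : {x : A | ∃ n : ℕ, p ^ n • x = 0}.Infinite) :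
    ∃ u : ℕ → A, (∀ n, p • u (n + 1) = u n) ∧ u 0 ≠ 0 ∧ p • u 0 = 0 := by
  classical
  let S : A → Set A := fun x => {y | ∃ n : ℕ, p ^ n • y = x}
  have hfib : ∀ x : A, {y : A | p • y = x}.Finite := fun x => by
    rcases {y : A | p • y = x}.eq_empty_or_nonempty with he | ⟨y, hy⟩
    · rw [he]; exact Set.finite_empty
    · refine (hfin.image (fun x => y + x)).subset fun z hz => ⟨z - y, ?_, add_sub_cancel y z⟩
      simp only [Set.mem_ofPred_eq] at hz hy ⊢
      rw [smul_sub, hz, hy, sub_self]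
  obtain ⟨x₀, hx₀, hpx₀, hS₀⟩ : ∃ x : A, x ≠ 0 ∧ p • x = 0 ∧ (S x).Infinite := by
    by_contra! hcon
    refine hinf (((Set.finite_singleton (0 : A)).union
      ((hfin.sdiff (t := {0})).biUnion (t := S) fun x hx => ?_)).subset ?_)
    · exact hcon x hx.2 hx.1
    · intro y hy
      by_cases hy0 : y = 0
      · exact Or.inl hy0
      · refine Or.inr ?_
        have hpos : Nat.find hy ≠ 0 := fun h0 => hy0 (by simpa [h0] using Nat.find_spec hy)
        obtain ⟨n, hn⟩ := Nat.exists_eq_succ_of_ne_zero hpos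
        have h1 := Nat.find_spec hy
        rw [hn, Nat.succ_eq_add_one, pow_succ', mul_smul] at h1
        exact Set.mem_biUnion (x := p ^ n • y) ⟨h1, Nat.find_min hy (by omega)⟩ ⟨n, rfl⟩
  have hstep : ∀ x : {x : A // (S x).Infinite}, ∃ y : {x : A // (S x).Infinite},
      p • (y : A) = x := by
    rintro ⟨x, hx⟩
    by_contra! hcon
    refine hx (((Set.finite_singleton x).union ((hfib x).biUnion (t := S) fun z hz => ?_)).subset ?_)
    · by_contra hz'
      exact hcon ⟨z, hz'⟩ hz
    · rintro y ⟨_ | n, hn⟩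
      · exact Or.inl (by simpa using hn)
      · rw [pow_succ', mul_smul] at hn
        exact Or.inr (Set.mem_biUnion (x := p ^ n • y) hn ⟨n, rfl⟩)
  choose next hnext using hstep
  exact ⟨fun n => (next^[n] ⟨x₀, hS₀⟩ : A), fun n => by
    simp only [Function.iterate_succ_apply', hnext],
    hx₀, hpx₀⟩

theorem exists_isThinFamily (hA : Infinite (AddCommGroup.torsion A)) (b : ℕ → ℕ) :
    ∃ (x₀ : A) (m : ℕ) (g : ℕ → A), IsThinFamily x₀ m g b := by
  by_cases h : ∀ p : ℕ, p.Prime → {x : A | p • x = 0}.Finite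
  · by_cases hP : {p : ℕ | p.Prime ∧ ∃ x : A, x ≠ 0 ∧ p • x = 0}.Finite
    · obtain ⟨p, hp, hinf⟩ := exists_infinite_primary hA h hP
      obtain ⟨u, hu, h0, hp0⟩ := exists_prufer_sequence (h p hp) hinf
      have := Fact.mk hp
      exact ⟨u 0, p, exists_isThinFamily_of_nsmul_succ hu h0 hp0 b⟩
    · obtain ⟨p, hp, x₀, hx₀, hpx₀⟩ := Set.Infinite.nonempty hP
      refine ⟨x₀, p, exists_isThinFamily_of_forall_finite hx₀ hp.pos hpx₀ (fun F _ B => ?_) b⟩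
      obtain ⟨q, ⟨hq, x, hx, hqx⟩, hlt⟩ := Set.Infinite.exists_gt hP (max B (Nat.card F))
      refine ⟨x, fun hxF => ?_, q, hq, hqx, Or.inr ((le_max_left _ _).trans_lt hlt)⟩
      have := Fact.mk hq
      have hord : addOrderOf (⟨x, hxF⟩ : F) = q := by
        rw [← AddSubgroup.addOrderOf_coe]
        exact addOrderOf_eq_prime hqx hx
      have := Nat.le_of_dvd Nat.card_pos (hord ▸ addOrderOf_dvd_natCard (⟨x, hxF⟩ : F))
      exact absurd this (not_le.2 ((le_max_right _ _).trans_lt hlt))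
  · push Not at h
    obtain ⟨p, hp, hinf⟩ := h
    obtain ⟨x₀, hpx₀, hx₀⟩ := hinf.exists_notMem_finite (Set.finite_singleton 0)
    refine ⟨x₀, p, exists_isThinFamily_of_forall_finite hx₀ hp.pos hpx₀ (fun F hF B => ?_) b⟩
    obtain ⟨x, hpx, hx⟩ := hinf.exists_notMem_finite (Set.toFinite (F : Set A))
    exact ⟨x, hx, p, hp, hpx, Or.inl rfl⟩

end Torsion

theorem theoremA (A : Type u) [AddCommGroup A] (hA : Infinite (AddCommGroup.torsion A)) :
    ∃ τ : TopologicalSpace A, @IsAlmostMaximallyAlmostPeriodic A _ τ := by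
  -- Thin families are built over `ℕ` for arbitrary bounds, so any enumeration of the vertices
  -- serves.
  let e := Denumerable.eqv (List ℕ)
  obtain ⟨x₀, m, g, h⟩ :=
    exists_isThinFamily hA ((fun v : List ℕ => 2 * (v.length + 1)) ∘ e.symm)
  exact ⟨_, (h.comp_equiv e).isAlmostMaximallyAlmostPeriodic⟩
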